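/- Let $\mathbf{zdK}_*$ be the category of Boolean pointed spaces $(X,*)$ (zero-dimensional compact Hausdorff spaces with a designated point) and continuous functions preserving the designated points. Let $\mathbf{iBa}$ be the category of idealized Boolean algebras $(B,I)$ ($B$ a Boolean algebra, $I$ a maximal ideal of $B$); a morphism $(B,I)\to(C,J)$ is a Boolean homomorphism $f\colon B\to C$ with $f^{-1}(J)=I$. Let $\mathbf{gBa}$ be the category of generalized Boolean algebras (distributive lattices with a least element $\bot$ such that for all $a,b$ there is a (necessarily unique) $c=a\smallsetminus b$ with $c\vee b=a\vee b$ and $c\wedge b=\bot$) and lattice homomorphisms preserving $\bot$. (1) The contravariant functors $$\mathcal{IB}\colon \mathbf{zdK}_*\to\mathbf{iBa},\quad (X,*)\mapsto(\operatorname{clop}X,\{b : *\notin b\}),\qquad \mathcal S_*\colon\mathbf{iBa}\to\mathbf{zdK}_*,\quad (B,I)\mapsto(\operatorname{uf}B,\,B\smallsetminus I),$$ where $\operatorname{clop}X$ is the Boolean algebra of clopen subsets of $X$, $\operatorname{uf}B$ is the Stone space of ultrafilters of $B$, and both functors act on morphisms by taking preimages, are mutually inverse equivalences between $\mathbf{zdK}_*$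 and $\mathbf{iBa}^{\mathrm{op}}$. (2) The (covariant) functors $$\mathcal F\colon\mathbf{iBa}\to\mathbf{gBa},\quad (B,I)\mapsto I,\qquad \mathcal B\colon\mathbf{gBa}\to\mathbf{iBa},\quad A\mapsto(B_A,A),$$ are mutually inverse equivalences of categories. Here $\mathcal F$ restricts a morphism to the ideals, and $B_A=A\cup A'$, with $A'=\{a' : a\in A\}$ a copy of $A$ disjoint from $A$, is the Boolean algebra with $\bot$, $\vee$ and $\wedge$ on $A$ as in $A$ and with $\neg a=a'$, $\neg a'=a$, $\top=\bot'$, $a_1\vee a_2'=(a_2\smallsetminus a_1)'$, $a_1'\vee a_2'=(a_1\wedge a_2)'$, $a_1\wedge a_2'=a_1\smallsetminus a_2$, $a_1'\wedge a_2'=(a_1\vee a_2)'$; $\mathcal B$ sends $f\colon A\to C$ to the map $a\mapsto f(a)$, $a'\mapsto f(a)'$. Here "mutually inverse" means up to natural isomorphism. -/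

import Mathlib

open CategoryTheory Opposite TopologicalSpace

universe u

namespace PointedStoneDuality

/-! ### Boolean pointed spaces -/

/-- A Boolean pointed space: a zero-dimensional compact Hausdorff space with a designated point.
Zero-dimensional means that the clopen subsets form a base of the topology. -/
structure ZdKPt where
  carrier : Type u
  [top : TopologicalSpace carrier]
  [compact : CompactSpace carrier]
  [t2 : T2Space carrier]
  zeroDim : IsTopologicalBasis {s : Set carrier | IsClopen s}
  pt : carrier

attribute [instance] ZdKPt.top ZdKPt.compact ZdKPt.t2

/-- A continuous pointed function. -/
@[ext]
structure ZdKPt.Hom (X Y : ZdKPt.{u}) where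
  toFun : X.carrier → Y.carrier
  continuous_toFun : Continuous toFun
  map_pt : toFun X.pt = Y.pt

instance : Category ZdKPt.{u} where
  Hom := ZdKPt.Hom
  id X := ⟨id, continuous_id, rfl⟩
  comp f g := ⟨g.toFun ∘ f.toFun, g.continuous_toFun.comp f.continuous_toFun, by
    simp [f.map_pt, g.map_pt]⟩

/-! ### Idealized Boolean algebras -/

/-- An idealized Boolean algebra: a Boolean algebra with a designated maximal ideal. -/
structure IBa where
  carrier : Type u
  [str : BooleanAlgebra carrier]
  ideal : Order.Ideal carrier
  isMaximal : ideal.IsMaximal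

attribute [instance] IBa.str

/-- A Boolean homomorphism `f : B → C` such that the preimage of the ideal of `C` is the ideal
of `B`. -/
@[ext]
structure IBa.Hom (B C : IBa.{u}) where
  toHom : BoundedLatticeHom B.carrier C.carrier
  preimage_ideal : toHom ⁻¹' (C.ideal : Set C.carrier) = (B.ideal : Set B.carrier)

instance : Category IBa.{u} where
  Hom := IBa.Hom
  id B := ⟨BoundedLatticeHom.id _, rfl⟩
  comp f g := ⟨g.toHom.comp f.toHom, by
    rw [← f.preimage_ideal, ← g.preimage_ideal]; rfl⟩

theorem IBa.Hom.mem_iff {B C : IBa.{u}} (f : IBa.Hom B C) (a : B.carrier) :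
    f.toHom a ∈ C.ideal ↔ a ∈ B.ideal :=
  Set.ext_iff.mp f.preimage_ideal a

theorem IBa.mem_or_compl_mem (B : IBa.{u}) (a : B.carrier) : a ∈ B.ideal ∨ aᶜ ∈ B.ideal :=
  haveI := B.isMaximal
  (inferInstance : B.ideal.IsPrime).mem_or_compl_mem

theorem IBa.top_notMem (B : IBa.{u}) : ⊤ ∉ B.ideal :=
  haveI := B.isMaximal
  Order.Ideal.IsProper.top_notMem inferInstance

/-- An ideal which is proper and contains each element or its complement is maximal. -/
theorem isMaximal_of_mem_or_compl_mem {B : Type u} [BooleanAlgebra B] (I : Order.Ideal B)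
    (h : ⊤ ∉ I) (h' : ∀ a, a ∈ I ∨ aᶜ ∈ I) : I.IsMaximal :=
  haveI : I.IsProper := Order.Ideal.isProper_of_notMem h
  haveI : I.IsPrime := Order.Ideal.isPrime_of_mem_or_compl_mem (h' _)
  inferInstance

/-! ### Generalized Boolean algebras -/

/-- A (bundled) generalized Boolean algebra. The relative complement carried by Mathlib's
class is uniquely determined by the lattice structure, and morphisms do not mention it. -/
structure GBa where
  carrier : Type u
  [str : GeneralizedBooleanAlgebra carrier]

attribute [instance] GBa.str

/-- A lattice homomorphism which preserves the bottom element. -/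
@[ext]
structure GBa.Hom (A C : GBa.{u}) where
  toHom : LatticeHom A.carrier C.carrier
  map_bot : toHom ⊥ = ⊥

instance : Category GBa.{u} where
  Hom := GBa.Hom
  id A := ⟨LatticeHom.id _, rfl⟩
  comp f g := ⟨g.toHom.comp f.toHom, by simp [f.map_bot, g.map_bot]⟩

theorem GBa.Hom.map_sdiff {A C : GBa.{u}} (f : GBa.Hom A C) (a b : A.carrier) :
    f.toHom (a \ b) = f.toHom a \ f.toHom b := by
  refine (sdiff_unique ?_ ?_).symm
  · rw [← map_inf, ← map_sup, sup_inf_sdiff]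
  · rw [← map_inf, ← map_inf, inf_inf_sdiff, f.map_bot]

/-! ### The space of ultrafilters of a Boolean algebra -/

/-- An ultrafilter of a Boolean algebra `B`: a proper upset, closed under binary meets, which
contains each element or its complement. -/
@[ext]
structure Uf (B : Type u) [BooleanAlgebra B] where
  sets : Set B
  top_mem : ⊤ ∈ sets
  bot_notMem : ⊥ ∉ sets
  mem_of_le : ∀ {a b : B}, a ≤ b → a ∈ sets → b ∈ sets
  inf_mem : ∀ {a b : B}, a ∈ sets → b ∈ sets → a ⊓ b ∈ sets
  mem_or_compl_mem : ∀ a : B, a ∈ sets ∨ aᶜ ∈ sets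

namespace Uf

variable {B C : Type u} [BooleanAlgebra B] [BooleanAlgebra C]

/-- The Stone topology, generated by the sets of ultrafilters containing a given element. -/
instance : TopologicalSpace (Uf B) :=
  generateFrom (Set.range fun a : B => {U : Uf B | a ∈ U.sets})

theorem compl_mem_iff (U : Uf B) (a : B) : aᶜ ∈ U.sets ↔ a ∉ U.sets := by
  constructor
  · intro h h'
    apply U.bot_notMem
    rw [← inf_compl_eq_bot (a := a)]
    exact U.inf_mem h' h
  · exact (U.mem_or_compl_mem a).resolve_left

theorem isClopen_basic (a : B) : IsClopen {U : Uf B | a ∈ U.sets} := by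
  refine ⟨⟨?_⟩, isOpen_generateFrom_of_mem ⟨a, rfl⟩⟩
  have : {U : Uf B | a ∈ U.sets}ᶜ = {U : Uf B | aᶜ ∈ U.sets} := by
    ext U; simp [compl_mem_iff]
  rw [this]
  exact isOpen_generateFrom_of_mem ⟨aᶜ, rfl⟩

open Classical in
/-- The characteristic function of an ultrafilter. -/
noncomputable def char (U : Uf B) : B → Bool := fun a => decide (a ∈ U.sets)

theorem char_eq_true (U : Uf B) (a : B) : U.char a = true ↔ a ∈ U.sets := by simp [char]

theorem isClosedEmbedding_char : Topology.IsClosedEmbedding (char : Uf B → B → Bool) := by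
  refine ⟨⟨⟨le_antisymm ?_ ?_⟩, ?_⟩, ?_⟩
  · rw [← continuous_iff_le_induced]
    refine continuous_pi fun a => ?_
    rw [continuous_bool_rng true]
    convert isClopen_basic a using 1
    ext U; simp [char_eq_true]
  · refine le_generateFrom ?_
    rintro _ ⟨a, rfl⟩
    refine ⟨{v | v a = true}, ?_, ?_⟩
    · exact (isOpen_discrete ({true} : Set Bool)).preimage
        (continuous_apply (A := fun _ : B => Bool) a)
    · ext U; simp [char_eq_true]
  · intro U V h
    ext a
    rw [← char_eq_true, h, char_eq_true]
  · have : Set.range (char : Uf B → B → Bool) =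
        {v | v ⊤ = true} ∩ {v | v ⊥ = false} ∩ (⋂ (a : B) (b : B), {v | v (a ⊓ b) = (v a && v b)})
          ∩ ⋂ a : B, {v | (v a || v aᶜ) = true} := by
      ext v
      simp only [Set.mem_range, Set.mem_inter_iff, Set.mem_iInter, Set.mem_ofPred_eq]
      constructor
      · rintro ⟨U, rfl⟩
        refine ⟨⟨⟨?_, ?_⟩, ?_⟩, ?_⟩
        · simpa [char_eq_true] using U.top_mem
        · simpa [char] using U.bot_notMem
        · intro a b
          rw [Bool.eq_iff_iff, Bool.and_eq_true, char_eq_true, char_eq_true, char_eq_true]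
          exact ⟨fun h => ⟨U.mem_of_le inf_le_left h, U.mem_of_le inf_le_right h⟩,
            fun h => U.inf_mem h.1 h.2⟩
        · intro a
          rw [Bool.or_eq_true, char_eq_true, char_eq_true]
          exact U.mem_or_compl_mem a
      · rintro ⟨⟨⟨h1, h2⟩, h3⟩, h4⟩
        refine ⟨⟨{a | v a = true}, h1, ?_, ?_, ?_, ?_⟩, ?_⟩
        · simp [h2]
        · intro a b hab (ha : v a = true)
          have := h3 a b
          rw [inf_eq_left.mpr hab, ha] at this
          simpa using this.symm
        · intro a b (ha : v a = true) (hb : v b = true)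
          change v (a ⊓ b) = true
          rw [h3, ha, hb]; rfl
        · intro a
          simpa using h4 a
        · ext a
          simp [char]
    rw [this]
    refine ((IsClosed.inter ?_ ?_).inter ?_).inter ?_
    · exact isClosed_eq (continuous_apply _) continuous_const
    · exact isClosed_eq (continuous_apply _) continuous_const
    · refine isClosed_iInter fun a => isClosed_iInter fun b => ?_
      have h : Continuous fun p : Bool × Bool => p.1 && p.2 := continuous_of_discreteTopology
      have h' : Continuous fun v : B → Bool => (v a, v b) := by fun_prop
      exact isClosed_eq (continuous_apply _) (h.comp h')
    · refine isClosed_iInter fun a => ?_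
      have h : Continuous fun p : Bool × Bool => p.1 || p.2 := continuous_of_discreteTopology
      have h' : Continuous fun v : B → Bool => (v a, v aᶜ) := by fun_prop
      exact isClosed_eq (h.comp h') continuous_const

instance : CompactSpace (Uf B) := isClosedEmbedding_char.compactSpace

instance : T2Space (Uf B) := isClosedEmbedding_char.isEmbedding.t2Space

theorem isTopologicalBasis_isClopen_uf : IsTopologicalBasis {s : Set (Uf B) | IsClopen s} :=
  haveI : TotallyDisconnectedSpace (Uf B) :=
    isClosedEmbedding_char.isEmbedding.isTotallyDisconnected_range.mp
      (isTotallyDisconnected_of_totallyDisconnectedSpace _)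
  isTopologicalBasis_isClopen

/-- The preimage of an ultrafilter under a Boolean homomorphism. -/
def comap (f : BoundedLatticeHom B C) (U : Uf C) : Uf B where
  sets := f ⁻¹' U.sets
  top_mem := by simpa using U.top_mem
  bot_notMem := by simpa using U.bot_notMem
  mem_of_le h := U.mem_of_le (OrderHomClass.mono f h)
  inf_mem ha hb := by simpa using U.inf_mem ha hb
  mem_or_compl_mem a := by simpa [map_compl'] using U.mem_or_compl_mem (f a)

theorem continuous_comap (f : BoundedLatticeHom B C) : Continuous (comap f) := by
  refine continuous_generateFrom_iff.mpr ?_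
  rintro _ ⟨a, rfl⟩
  exact isOpen_generateFrom_of_mem ⟨f a, rfl⟩

end Uf

/-- The ultrafilter `B \ I` of an idealized Boolean algebra `(B, I)`. -/
def IBa.complUf (B : IBa.{u}) : Uf B.carrier where
  sets := (B.ideal : Set B.carrier)ᶜ
  top_mem := B.top_notMem
  bot_notMem h := h B.ideal.bot_mem
  mem_of_le h ha hb := ha (B.ideal.lower h hb)
  inf_mem {a b} ha hb h := by
    have ha' := (B.mem_or_compl_mem a).resolve_left ha
    have hb' := (B.mem_or_compl_mem b).resolve_left hb
    have : (a ⊓ b) ⊔ (aᶜ ⊔ bᶜ) ∈ B.ideal :=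
      Order.Ideal.sup_mem h (Order.Ideal.sup_mem ha' hb')
    rw [← compl_inf, sup_compl_eq_top] at this
    exact B.top_notMem this
  mem_or_compl_mem a := by
    by_contra h
    simp only [Set.mem_compl_iff, SetLike.mem_coe, not_or, not_not] at h
    have := Order.Ideal.sup_mem h.1 h.2
    rw [sup_compl_eq_top] at this
    exact B.top_notMem this

/-! ### The functors -/

/-- The object `(uf B, B \ I)` assigned to `(B, I)`. -/
def ufObj (B : IBa.{u}) : ZdKPt.{u} where
  carrier := Uf B.carrier
  zeroDim := Uf.isTopologicalBasis_isClopen_uf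
  pt := B.complUf

/-- The (contravariant) functor `(B, I) ↦ (uf B, B \ I)`, with `f ↦ f⁻¹` on morphisms. -/
def SStar : IBa.{u}ᵒᵖ ⥤ ZdKPt.{u} where
  obj B := ufObj B.unop
  map {B C} f :=
    { toFun := Uf.comap f.unop.toHom
      continuous_toFun := Uf.continuous_comap _
      map_pt := Uf.ext (congrArg compl f.unop.preimage_ideal) }

/-- The ideal of clopen subsets which do not contain the designated point. -/
def clopIdeal (X : ZdKPt.{u}) : Order.Ideal (Clopens X.carrier) :=
  Order.IsIdeal.toIdeal (I := {b | X.pt ∉ b})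
    { IsLowerSet := fun _ _ h ha hb => ha (h hb)
      Nonempty := ⟨⊥, fun h => h⟩
      Directed := fun a ha b hb => ⟨a ⊔ b, fun h => h.elim ha hb, le_sup_left, le_sup_right⟩ }

/-- The object `(clop X, {b | * ∉ b})` assigned to `(X, *)`. -/
def clopObj (X : ZdKPt.{u}) : IBa.{u} where
  carrier := Clopens X.carrier
  ideal := clopIdeal X
  isMaximal := isMaximal_of_mem_or_compl_mem _ (fun h => h trivial)
    (fun b => (em (X.pt ∈ b)).symm.imp id fun h h' => h' h)

/-- The preimage homomorphism of clopen algebras induced by a continuous pointed function. -/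
def clopMap {X Y : ZdKPt.{u}} (f : ZdKPt.Hom X Y) : IBa.Hom (clopObj Y) (clopObj X) where
  toHom :=
    { toFun := fun b : Clopens Y.carrier =>
        (⟨f.toFun ⁻¹' b, b.isClopen.preimage f.continuous_toFun⟩ : Clopens X.carrier)
      map_sup' := fun _ _ => rfl
      map_inf' := fun _ _ => rfl
      map_top' := rfl
      map_bot' := rfl }
  preimage_ideal := by
    ext b
    change f.toFun X.pt ∉ (show Clopens Y.carrier from b) ↔
      Y.pt ∉ (show Clopens Y.carrier from b)
    rw [f.map_pt]

/-- The (contravariant) functor `(X, *) ↦ (clop X, {b | * ∉ b})`, with `f ↦ f⁻¹` on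
morphisms. -/
def IB : ZdKPt.{u} ⥤ IBa.{u}ᵒᵖ where
  obj X := op (clopObj X)
  map f := Quiver.Hom.op (clopMap f)

/-- An ideal of a Boolean algebra, with the inherited order and lattice operations, and with
relative complement `a ⊓ bᶜ`, is a generalized Boolean algebra. -/
abbrev idealGBA {B : Type u} [BooleanAlgebra B] (I : Order.Ideal B) :
    GeneralizedBooleanAlgebra I :=
  letI : Max I := ⟨fun a b => ⟨a.1 ⊔ b.1, Order.Ideal.sup_mem a.2 b.2⟩⟩
  letI : Min I := ⟨fun a b => ⟨a.1 ⊓ b.1, I.lower inf_le_left a.2⟩⟩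
  letI : Bot I := ⟨⟨⊥, I.bot_mem⟩⟩
  letI : SDiff I := ⟨fun a b => ⟨a.1 ⊓ b.1ᶜ, I.lower inf_le_left a.2⟩⟩
  Subtype.val_injective.generalizedBooleanAlgebra (fun a : I => a.1) Iff.rfl Iff.rfl
    (fun _ _ => rfl) (fun _ _ => rfl) rfl (fun _ _ => sdiff_eq.symm)

/-- The forgetful functor `(B, I) ↦ I`, with `f ↦ f|I` on morphisms. -/
def forgetToGBa : IBa.{u} ⥤ GBa.{u} where
  obj B := { carrier := B.ideal, str := idealGBA B.ideal }
  map {B C} f :=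
    letI := idealGBA B.ideal
    letI := idealGBA C.ideal
    { toHom :=
        { toFun := fun a : B.ideal => (⟨f.toHom a.1, (f.mem_iff a.1).mpr a.2⟩ : C.ideal)
          map_sup' := fun a b => Subtype.ext (map_sup f.toHom a.1 b.1)
          map_inf' := fun a b => Subtype.ext (map_inf f.toHom a.1 b.1) }
      map_bot := Subtype.ext (map_bot f.toHom) }

/-- The copy of `A` in `B_A = A ∪ A'`, as an ideal. Mathlib's `Booleanisation A` is the disjoint
union of `A` (through `lift`) and a set of formal complements (through `comp`). -/
def liftIdeal (A : Type u) [GeneralizedBooleanAlgebra A] : Order.Ideal (Booleanisation A) :=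
  Order.IsIdeal.toIdeal (I := Set.range Booleanisation.lift)
    { IsLowerSet := by
        rintro _ (b | b) h ⟨a, rfl⟩
        · exact ⟨b, rfl⟩
        · exact absurd h Booleanisation.not_comp_le_lift
      Nonempty := ⟨_, ⊥, rfl⟩
      Directed := by
        rintro _ ⟨a, rfl⟩ _ ⟨b, rfl⟩
        exact ⟨_, ⟨a ⊔ b, rfl⟩, Booleanisation.lift_le_lift.mpr le_sup_left,
          Booleanisation.lift_le_lift.mpr le_sup_right⟩ }

/-- The object `(B_A, A)` assigned to `A`. -/
def booleanisationObj (A : GBa.{u}) : IBa.{u} where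
  carrier := Booleanisation A.carrier
  ideal := liftIdeal A.carrier
  isMaximal := by
    refine isMaximal_of_mem_or_compl_mem _ ?_ ?_
    · rintro ⟨a, h⟩
      cases h
    · rintro (a | a)
      · exact Or.inl ⟨a, rfl⟩
      · exact Or.inr ⟨a, rfl⟩

/-- The map `B_A → B_C` induced by `f : A → C`: `a ↦ f a` and `a' ↦ (f a)'`. -/
def booleanisationFun {A C : GBa.{u}} (f : GBa.Hom A C) :
    Booleanisation A.carrier → Booleanisation C.carrier
  | .lift a => .lift (f.toHom a)
  | .comp a => .comp (f.toHom a)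

/-- `booleanisationFun` as an idealized Boolean homomorphism. -/
def booleanisationMap {A C : GBa.{u}} (f : GBa.Hom A C) :
    IBa.Hom (booleanisationObj A) (booleanisationObj C) where
  toHom :=
    { toFun := booleanisationFun f
      map_sup' := by
        rintro (a | a) (b | b)
        · exact congrArg Booleanisation.lift (map_sup f.toHom a b)
        · exact congrArg Booleanisation.comp (f.map_sdiff b a)
        · exact congrArg Booleanisation.comp (f.map_sdiff a b)
        · exact congrArg Booleanisation.comp (map_inf f.toHom a b)
      map_inf' := by
        rintro (a | a) (b | b)
        · exact congrArg Booleanisation.lift (map_inf f.toHom a b)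
        · exact congrArg Booleanisation.lift (f.map_sdiff a b)
        · exact congrArg Booleanisation.lift (f.map_sdiff b a)
        · exact congrArg Booleanisation.comp (map_sup f.toHom a b)
      map_top' := congrArg Booleanisation.comp f.map_bot
      map_bot' := congrArg Booleanisation.lift f.map_bot }
  preimage_ideal := by
    ext (a | a)
    · exact ⟨fun _ => ⟨a, rfl⟩, fun _ => ⟨f.toHom a, rfl⟩⟩
    · constructor
      · rintro ⟨b, h⟩
        cases h
      · rintro ⟨b, h⟩
        cases h

/-- The functor `A ↦ (B_A, A)`. -/
def booleanisation : GBa.{u} ⥤ IBa.{u} where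
  obj := booleanisationObj
  map := booleanisationMap
  map_id A := by
    refine IBa.Hom.ext (DFunLike.ext _ _ ?_)
    rintro (a | a) <;> rfl
  map_comp f g := by
    refine IBa.Hom.ext (DFunLike.ext _ _ ?_)
    rintro (a | a) <;> rfl

end PointedStoneDuality

/-! Part (1) is Stone duality with a point carried along. A point of a Boolean space gives the
ultrafilter of clopen sets containing it, and an element of a Boolean algebra gives the clopen set
of ultrafilters containing it. Both maps are bijective (`bijective_pointHom`, `bijective_stoneHom`):
the first by compactness and separation by clopen sets, the second by the Boolean prime ideal
theorem and compactness of the Stone space. The designated data match because a maximal ideal and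
its complementary ultrafilter determine each other.

Part (2) holds because a maximal ideal `I` of `B` contains exactly one of `a` and `aᶜ` for each `a`,
so `B` is the disjoint union of `I` and the complements of elements of `I`. This is the shape of the
Booleanisation of `I` (`bijective_ofBooleanisation`).

In all three categories a bijective morphism is invertible, so bijectivity and naturality suffice.
-/

namespace PointedStoneDuality

/-! ### Isomorphisms in the three categories -/

/-- A bijective continuous pointed function is an isomorphism. -/
noncomputable def ZdKPt.isoOfBijective {X Y : ZdKPt.{u}} (f : X ⟶ Y)
    (hf : Function.Bijective (ZdKPt.Hom.toFun f)) : X ≅ Y where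
  hom := f
  inv :=
    { toFun := (Equiv.ofBijective _ hf).symm
      continuous_toFun := Continuous.continuous_symm_of_equiv_compact_to_t2
        (f := Equiv.ofBijective _ hf) (ZdKPt.Hom.continuous_toFun f)
      map_pt := (Equiv.symm_apply_eq _).mpr (ZdKPt.Hom.map_pt f).symm }
  hom_inv_id := ZdKPt.Hom.ext (funext fun x => (Equiv.ofBijective _ hf).symm_apply_apply x)
  inv_hom_id := ZdKPt.Hom.ext (funext fun y => (Equiv.ofBijective _ hf).apply_symm_apply y)

/-- A bijective idealized Boolean homomorphism is an isomorphism. -/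
noncomputable def IBa.isoOfBijective {B C : IBa.{u}} (f : B ⟶ C)
    (hf : Function.Bijective (IBa.Hom.toHom f)) : B ≅ C where
  hom := f
  inv :=
    { toHom :=
        { toFun := (Equiv.ofBijective _ hf).symm
          map_sup' := fun a b => hf.1 <| by
            simp only [map_sup, Equiv.ofBijective_apply_symm_apply]
          map_inf' := fun a b => hf.1 <| by
            simp only [map_inf, Equiv.ofBijective_apply_symm_apply]
          map_top' := (Equiv.symm_apply_eq _).mpr (map_top (IBa.Hom.toHom f)).symm
          map_bot' := (Equiv.symm_apply_eq _).mpr (map_bot (IBa.Hom.toHom f)).symm }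
      preimage_ideal := by
        ext a
        -- The condition on ideals is an equivalence, so `f` both preserves and reflects membership
        -- and the inverse inherits it.
        refine (IBa.Hom.mem_iff f _).symm.trans ?_
        exact iff_of_eq (congrArg (· ∈ C.ideal) ((Equiv.ofBijective _ hf).apply_symm_apply a)) }
  hom_inv_id := IBa.Hom.ext
    (DFunLike.ext _ _ fun a => (Equiv.ofBijective _ hf).symm_apply_apply a)
  inv_hom_id := IBa.Hom.ext
    (DFunLike.ext _ _ fun a => (Equiv.ofBijective _ hf).apply_symm_apply a)

/-- A bijective homomorphism of generalized Boolean algebras is an isomorphism. -/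
noncomputable def GBa.isoOfBijective {A C : GBa.{u}} (f : A ⟶ C)
    (hf : Function.Bijective (GBa.Hom.toHom f)) : A ≅ C where
  hom := f
  inv :=
    { toHom :=
        { toFun := (Equiv.ofBijective _ hf).symm
          map_sup' := fun a b => hf.1 <| by
            simp only [map_sup, Equiv.ofBijective_apply_symm_apply]
          map_inf' := fun a b => hf.1 <| by
            simp only [map_inf, Equiv.ofBijective_apply_symm_apply] }
      map_bot := (Equiv.symm_apply_eq _).mpr (GBa.Hom.map_bot f).symm }
  hom_inv_id := GBa.Hom.ext
    (DFunLike.ext _ _ fun a => (Equiv.ofBijective _ hf).symm_apply_apply a)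
  inv_hom_id := GBa.Hom.ext
    (DFunLike.ext _ _ fun a => (Equiv.ofBijective _ hf).apply_symm_apply a)

/-! ### Ultrafilters and clopen sets -/

namespace Uf

variable {B : Type u} [BooleanAlgebra B]

/-- Ultrafilters are maximal: an element of `V` outside `U` would have its complement in `U`, hence
in `V`. -/
theorem ext_of_subset {U V : Uf B} (h : U.sets ⊆ V.sets) : U = V := by
  refine Uf.ext (h.antisymm fun a ha => ?_)
  by_contra ha'
  exact (V.compl_mem_iff a).mp (h ((U.compl_mem_iff a).mpr ha')) ha

theorem sup_mem_iff (U : Uf B) (a b : B) : a ⊔ b ∈ U.sets ↔ a ∈ U.sets ∨ b ∈ U.sets := by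
  constructor
  · intro h
    by_contra! h'
    have := U.inf_mem ((U.compl_mem_iff a).mpr h'.1) ((U.compl_mem_iff b).mpr h'.2)
    rw [← compl_sup, compl_mem_iff] at this
    exact this h
  · rintro (h | h)
    exacts [U.mem_of_le le_sup_left h, U.mem_of_le le_sup_right h]

theorem inf_mem_iff (U : Uf B) (a b : B) : a ⊓ b ∈ U.sets ↔ a ∈ U.sets ∧ b ∈ U.sets :=
  ⟨fun h => ⟨U.mem_of_le inf_le_left h, U.mem_of_le inf_le_right h⟩, fun h => U.inf_mem h.1 h.2⟩

/-- The Boolean prime ideal theorem: a nonzero element belongs to some ultrafilter. -/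
theorem exists_mem_of_ne_bot {a : B} (ha : a ≠ ⊥) : ∃ U : Uf B, a ∈ U.sets := by
  -- A prime ideal avoiding the principal filter of `a` exists because that filter misses the zero
  -- ideal. Prime ideals of a Boolean algebra are maximal, so the complement of `J` is the required
  -- ultrafilter.
  obtain ⟨J, hJ, -, hd⟩ := DistribLattice.prime_ideal_of_disjoint_filter_ideal
    (F := Order.PFilter.principal a) (I := Order.Ideal.principal ⊥) (by
      refine Set.disjoint_left.mpr fun x hx hx' => ha ?_
      exact le_bot_iff.mp ((Order.PFilter.mem_principal.mp hx).trans
        (Order.Ideal.mem_principal.mp hx')))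
  exact ⟨IBa.complUf ⟨B, J, inferInstance⟩,
    Set.disjoint_left.mp hd (Order.PFilter.mem_principal.mpr le_rfl)⟩

/-- If `a ≤ b` fails, then `a ⊓ bᶜ` is nonzero, and an ultrafilter containing it contains `a` but
not `b`. -/
theorem le_of_forall_mem {a b : B} (h : ∀ U : Uf B, a ∈ U.sets → b ∈ U.sets) : a ≤ b := by
  by_contra hab
  obtain ⟨U, hU⟩ := exists_mem_of_ne_bot (a := a ⊓ bᶜ)
    (fun h' => hab (disjoint_compl_right_iff.mp (disjoint_iff.mpr h')))
  rw [inf_mem_iff, compl_mem_iff] at hU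
  exact hU.2 (h U hU.1)

/-- The generating sets are closed under binary intersection and include the whole space, so the
subbasis is already a basis. -/
theorem isTopologicalBasis_basic :
    IsTopologicalBasis (Set.range fun a : B => {U : Uf B | a ∈ U.sets}) := by
  have := isTopologicalBasis_of_subbasis_of_inter
    (r := Set.range fun a : B => {U : Uf B | a ∈ U.sets}) rfl (by
      rintro _ ⟨a, rfl⟩ _ ⟨b, rfl⟩
      exact ⟨a ⊓ b, Set.ext fun U => U.inf_mem_iff a b⟩)
  have htop : Set.univ ∈ Set.range fun a : B => {U : Uf B | a ∈ U.sets} :=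
    ⟨⊤, Set.eq_univ_of_forall fun U => U.top_mem⟩
  rwa [Set.insert_eq_of_mem htop] at this

/-- Every clopen set of ultrafilters consists of the ultrafilters containing some element. -/
theorem exists_eq_basic {s : Set (Uf B)} (hs : IsClopen s) :
    ∃ a : B, {U : Uf B | a ∈ U.sets} = s := by
  -- A clopen set is compact and open, hence a finite union of basic sets. Such a union is again
  -- basic, because ultrafilters are prime: the join of the elements represents it.
  obtain ⟨t, ht, rfl⟩ := eq_finite_iUnion_of_isTopologicalBasis_of_isCompact_open _
    isTopologicalBasis_basic s hs.isClosed.isCompact hs.isOpen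
  clear hs
  induction t, ht using Set.Finite.induction_on with
  | empty => exact ⟨⊥, by ext U; simpa using U.bot_notMem⟩
  | @insert a t _ _ ih =>
    obtain ⟨b, hb⟩ := ih
    refine ⟨a ⊔ b, ?_⟩
    rw [Set.biUnion_insert, ← hb]
    exact Set.ext fun U => U.sup_mem_iff a b

end Uf

/-! ### Unit and counit of pointed Stone duality -/

/-- The element `a` of `B`, seen as the clopen set of ultrafilters containing `a`. -/
def stoneHom (B : IBa.{u}) : B ⟶ clopObj (ufObj B) where
  toHom :=
    { toFun := fun a => (⟨{U : Uf B.carrier | a ∈ U.sets}, Uf.isClopen_basic a⟩ :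
        Clopens (Uf B.carrier))
      map_sup' := fun a b => Clopens.ext (Set.ext fun U => U.sup_mem_iff a b)
      map_inf' := fun a b => Clopens.ext (Set.ext fun U => U.inf_mem_iff a b)
      map_top' := Clopens.ext (Set.eq_univ_of_forall fun U => U.top_mem)
      map_bot' := Clopens.ext (Set.eq_empty_of_forall_notMem fun U => U.bot_notMem) }
  -- The designated ultrafilter is the complement of the ideal, so missing it amounts to lying in
  -- the ideal, up to a double negation.
  preimage_ideal := Set.ext fun _ => not_not

theorem bijective_stoneHom (B : IBa.{u}) : Function.Bijective (IBa.Hom.toHom (stoneHom B)) := by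
  constructor
  · intro a b h
    have h' : ∀ U : Uf B.carrier, a ∈ U.sets ↔ b ∈ U.sets := fun U =>
      Set.ext_iff.mp (congrArg (fun s : Clopens (Uf B.carrier) => (s : Set (Uf B.carrier))) h) U
    exact (Uf.le_of_forall_mem fun U => (h' U).mp).antisymm
      (Uf.le_of_forall_mem fun U => (h' U).mpr)
  · intro s
    obtain ⟨a, ha⟩ := Uf.exists_eq_basic (Clopens.isClopen (α := Uf B.carrier) s)
    exact ⟨a, Clopens.ext ha⟩

/-- The ultrafilter of clopen sets containing a given point. -/
def pointUf {X : Type u} [TopologicalSpace X] (x : X) : Uf (Clopens X) where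
  sets := {s | x ∈ s}
  top_mem := trivial
  bot_notMem h := h
  mem_of_le h hx := h hx
  inf_mem hs ht := ⟨hs, ht⟩
  mem_or_compl_mem s := em (x ∈ s)

theorem continuous_pointUf {X : Type u} [TopologicalSpace X] :
    Continuous (pointUf : X → Uf (Clopens X)) := by
  refine continuous_generateFrom_iff.mpr ?_
  rintro _ ⟨s, rfl⟩
  exact s.isClopen.isOpen

/-- The members of an ultrafilter `U` form a directed family of nonempty compact closed sets.
Compactness gives a common point `x`, so `U` is contained in the ultrafilter of `x`, and maximality
makes them equal. -/
theorem surjective_pointUf {X : Type u} [TopologicalSpace X] [CompactSpace X] :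
    Function.Surjective (pointUf : X → Uf (Clopens X)) := by
  intro U
  have : Nonempty U.sets := ⟨⟨⊤, U.top_mem⟩⟩
  obtain ⟨x, hx⟩ := IsCompact.nonempty_iInter_of_directed_nonempty_isCompact_isClosed
    (fun s : U.sets => ((s : Clopens X) : Set X))
    (fun s t => ⟨⟨s.1 ⊓ t.1, U.inf_mem s.2 t.2⟩, Set.inter_subset_left, Set.inter_subset_right⟩)
    (fun s => Set.nonempty_iff_ne_empty.mpr fun h => U.bot_notMem <| by
      have : (s : Clopens X) = ⊥ := Clopens.ext h
      exact this ▸ s.2)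
    (fun s => s.1.isClopen.isClosed.isCompact) (fun s => s.1.isClopen.isClosed)
  exact ⟨x, (Uf.ext_of_subset fun s hs => Set.mem_iInter.mp hx ⟨s, hs⟩).symm⟩

/-- The evaluation map from a Boolean pointed space to the ultrafilters of its clopen sets. -/
def pointHom (X : ZdKPt.{u}) : X ⟶ ufObj (clopObj X) where
  toFun := (pointUf : X.carrier → Uf (Clopens X.carrier))
  continuous_toFun := continuous_pointUf
  map_pt := Uf.ext (Set.ext fun _ => not_not.symm)

theorem bijective_pointHom (X : ZdKPt.{u}) : Function.Bijective (ZdKPt.Hom.toFun (pointHom X)) := by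
  refine ⟨fun x y h => ?_, surjective_pointUf⟩
  by_contra hxy
  -- Zero-dimensionality gives a clopen set containing `x` but not `y`, which distinguishes their
  -- ultrafilters.
  obtain ⟨s, hs, hxs, hsy⟩ := X.zeroDim.exists_subset_of_mem_open
    (show x ∈ ({y}ᶜ : Set X.carrier) from hxy) isOpen_compl_singleton
  have := Set.ext_iff.mp (congrArg (Uf.sets (B := Clopens X.carrier)) h) ⟨s, hs⟩
  exact hsy (this.mp hxs) rfl

/-- A Boolean pointed space is naturally isomorphic to the space of ultrafilters of its clopen
sets. -/
noncomputable def pointIso : 𝟭 ZdKPt.{u} ≅ IB ⋙ SStar :=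
  NatIso.ofComponents (fun X => ZdKPt.isoOfBijective (pointHom X) (bijective_pointHom X))
    (fun _ => rfl)

/-- Stone's representation of idealized Boolean algebras, as a natural isomorphism. -/
noncomputable def stoneIso : SStar ⋙ IB ≅ 𝟭 IBa.{u}ᵒᵖ :=
  NatIso.ofComponents
    (fun B => (IBa.isoOfBijective (stoneHom B.unop) (bijective_stoneHom B.unop)).op)
    (fun _ => rfl)

/-! ### Idealized and generalized Boolean algebras -/

/-- The map `B_I → B` which is the inclusion on `I` and sends `a'` to the complement of `a`. -/
def ofBooleanisationFun {B : Type u} [BooleanAlgebra B] (I : Order.Ideal B) :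
    Booleanisation I → B
  | .lift a => a.1
  | .comp a => a.1ᶜ

/-- The homomorphism `B_I → B` extending the inclusion of `I`. -/
def ofBooleanisation (B : IBa.{u}) : booleanisation.obj (forgetToGBa.obj B) ⟶ B where
  toHom :=
    { toFun := ofBooleanisationFun B.ideal
      map_sup' := by
        rintro (a | a) (b | b)
        · rfl
        · change (b.1 ⊓ a.1ᶜ)ᶜ = a.1 ⊔ b.1ᶜ
          rw [compl_inf, compl_compl, sup_comm]
        · change (a.1 ⊓ b.1ᶜ)ᶜ = a.1ᶜ ⊔ b.1
          rw [compl_inf, compl_compl]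
        · exact compl_inf
      map_inf' := by
        rintro (a | a) (b | b)
        · rfl
        · rfl
        · exact inf_comm _ _
        · exact compl_sup
      map_top' := compl_bot
      map_bot' := rfl }
  preimage_ideal := by
    ext (a | a)
    · exact ⟨fun _ => ⟨a, rfl⟩, fun _ => a.2⟩
    · constructor
      · intro (h : a.1ᶜ ∈ B.ideal)
        refine absurd ?_ B.top_notMem
        rw [← sup_compl_eq_top (x := a.1)]
        exact Order.Ideal.sup_mem a.2 h
      · rintro ⟨b, h⟩
        cases h

/-- Surjectivity is maximality of the ideal: each element or its complement lies in it. Injectivity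
is properness, which keeps the ideal disjoint from the set of complements of its elements. -/
theorem bijective_ofBooleanisation (B : IBa.{u}) :
    Function.Bijective (IBa.Hom.toHom (ofBooleanisation B)) := by
  -- If `a = bᶜ` with both `a` and `b` in the ideal, then so is `a ⊔ b = ⊤`.
  have disj (a b : B.ideal) : a.1 ≠ b.1ᶜ := fun h => B.top_notMem <| by
    rw [← compl_sup_eq_top (x := b.1), ← h]
    exact Order.Ideal.sup_mem a.2 b.2
  constructor
  · rintro (a | a) (b | b) h
    · exact congrArg Booleanisation.lift (Subtype.ext h)
    · exact absurd h (disj a b)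
    · exact absurd h.symm (disj b a)
    · exact congrArg Booleanisation.comp (Subtype.ext (compl_injective h))
  · intro a
    rcases B.mem_or_compl_mem a with h | h
    · exact ⟨Booleanisation.lift (⟨a, h⟩ : B.ideal), rfl⟩
    · exact ⟨Booleanisation.comp (⟨aᶜ, h⟩ : B.ideal), compl_compl a⟩

/-- The inclusion of `A` into `B_A`, with values in the distinguished ideal. -/
def toLiftIdeal (A : GBa.{u}) : A ⟶ forgetToGBa.obj (booleanisation.obj A) :=
  letI := idealGBA (liftIdeal A.carrier)
  { toHom :=
      { toFun := fun a => (⟨.lift a, a, rfl⟩ : liftIdeal A.carrier)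
        map_sup' := fun _ _ => rfl
        map_inf' := fun _ _ => rfl }
    map_bot := rfl }

theorem bijective_toLiftIdeal (A : GBa.{u}) :
    Function.Bijective (GBa.Hom.toHom (toLiftIdeal A)) := by
  constructor
  · intro a b h
    exact Sum.inl_injective (congrArg Subtype.val h)
  · rintro ⟨_, a, rfl⟩
    exact ⟨a, rfl⟩

/-- An idealized Boolean algebra is naturally isomorphic to the Booleanisation of its ideal. -/
noncomputable def ofBooleanisationIso : forgetToGBa ⋙ booleanisation ≅ 𝟭 IBa.{u} :=
  NatIso.ofComponents
    (fun B => IBa.isoOfBijective (ofBooleanisation B) (bijective_ofBooleanisation B))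
    (fun f => by
      refine IBa.Hom.ext (DFunLike.ext _ _ ?_)
      rintro (a | a)
      · rfl
      -- On formal complements, naturality is the fact that Boolean homomorphisms preserve
      -- complements.
      · exact (map_compl' (IBa.Hom.toHom f) a.1).symm)

/-- A generalized Boolean algebra is naturally isomorphic to the ideal of its Booleanisation. -/
noncomputable def toLiftIdealIso : 𝟭 GBa.{u} ≅ booleanisation ⋙ forgetToGBa :=
  NatIso.ofComponents (fun A => GBa.isoOfBijective (toLiftIdeal A) (bijective_toLiftIdeal A))
    (fun _ => rfl)

end PointedStoneDuality

theorem theorem14 :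
    (∃ e : PointedStoneDuality.ZdKPt.{u} ≌ PointedStoneDuality.IBa.{u}ᵒᵖ,
      e.functor = PointedStoneDuality.IB ∧ e.inverse = PointedStoneDuality.SStar) ∧
    (∃ e : PointedStoneDuality.IBa.{u} ≌ PointedStoneDuality.GBa.{u},
      e.functor = PointedStoneDuality.forgetToGBa ∧
        e.inverse = PointedStoneDuality.booleanisation) := by
  -- `Equivalence.mk` adjusts the unit to satisfy the triangle identity and leaves both functors
  -- untouched, so the two equalities hold by `rfl`.
  exact ⟨⟨CategoryTheory.Equivalence.mk _ _ PointedStoneDuality.pointIso PointedStoneDuality.stoneIso, rfl, rfl⟩,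
    ⟨CategoryTheory.Equivalence.mk _ _ PointedStoneDuality.ofBooleanisationIso.symm
      PointedStoneDuality.toLiftIdealIso.symm, rfl, rfl⟩⟩
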